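/- Let $W\subseteq\mathbb{R}^n$ be open and convex with $\mathbb{R}^n_+\subseteq W$, and let $f,g:W\to\mathbb{R}^n$ be continuously differentiable. Assume that $f$ is cooperative on $\mathbb{R}^n_+$ (that is, $\partial f_i/\partial x_j(a)\ge 0$ for all $i\ne j$ and $a\in\mathbb{R}^n_+$), that $g$ is order-preserving on $\mathbb{R}^n_+$ (that is, $g(x)\le g(y)$ whenever $x,y\in\mathbb{R}^n_+$ and $x\le y$, inequalities between vectors being componentwise), and that for some $\alpha>0$ both are sub-homogeneous of degree $\alpha$ on $\mathbb{R}^n_+$ (that is, $f(\lambda x)\le\lambda^\alpha f(x)$ and $g(\lambda x)\le\lambda^\alpha g(x)$ for all $x\in\mathbb{R}^n_+$ and $\lambda\ge 1$). For $\tau_{\max}\ge 0$ and continuous delays $\tau^i_j:[0,\infty)\to[0,\tau_{\max}]$, $1\le i,j\le n$, consider $$\dot x_i(t)=f_i(x(t))+g_i\bigl(x_1(t-\tau^i_1(t)),\dots,x_n(t-\tau^i_n(t))\bigr)\quad (t\ge 0),\qquad x(t)=\varphi(t)\quad (t\in[-\tau_{\max},0]),\tag{1}$$ with continuous initial conditions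 $\varphi:[-\tau_{\max},0]\to\mathbb{R}^n_+$. A point $x^\star\in\mathbb{R}^n_+$ with $f(x^\star)+g(x^\star)=0$ is called a globally asymptotically stable equilibrium of (1) if for every such $\varphi$ the solution exists for all $t\ge 0$ and converges to $x^\star$ as $t\to\infty$, and if for every $\varepsilon>0$ there is $\delta>0$ such that $\|\varphi(t)-x^\star\|<\delta$ for all $t\in[-\tau_{\max},0]$ implies $\|x(t)-x^\star\|<\varepsilon$ for all $t\ge 0$. Then, for every $x^\star\in\mathbb{R}^n$, the following are equivalent: (a) $x^\star$ is a globally asymptotically stable equilibrium of the system without delay, $\dot x=f(x)+g(x)$ (that is, (1) with $\tau_{\max}=0$); (b) $x^\star$ is a globally asymptotically stable equilibrium of (1) for all $\tau_{\max}\ge 0$ and all continuous delays $\tau^i_j:[0,\infty)\to[0,\tau_{\max}]$; (c) $x^\star$ is a globally asymptotically stable equilibrium of (1) for some $\tau_{\max}\ge 0$ and some continuous delays $\tau^i_j:[0,\infty)\to[0,\tau_{\max}]$. -/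

import Mathlib

open Set Filter Topology

namespace DelaySystem

/-- The nonnegative orthant `ℝⁿ₊`. -/
def orthant (n : ℕ) : Set (Fin n → ℝ) := {x | ∀ i, 0 ≤ x i}

/-- The Jacobian matrix of `f` at `a`: the entry `(i, j)` is `∂fᵢ/∂xⱼ (a)`. -/
noncomputable def jacobian {n : ℕ} (f : (Fin n → ℝ) → (Fin n → ℝ)) (a : Fin n → ℝ) :
    Matrix (Fin n) (Fin n) ℝ :=
  Matrix.of fun i j => fderiv ℝ f a (Pi.single j 1) i

/-- A square matrix is Metzler if its off-diagonal entries are nonnegative. -/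
def IsMetzler {n : ℕ} (A : Matrix (Fin n) (Fin n) ℝ) : Prop :=
  ∀ i j, i ≠ j → 0 ≤ A i j

/-- Cooperativity on `S` of a vector field that is differentiable at the points of `S`:
the Jacobian is Metzler at every point of `S`. -/
def CooperativeOn {n : ℕ} (f : (Fin n → ℝ) → (Fin n → ℝ)) (S : Set (Fin n → ℝ)) : Prop :=
  ∀ a ∈ S, IsMetzler (jacobian f a)

/-- `g` is order-preserving on `S` (for the componentwise order). -/
def OrderPreservingOn {n : ℕ} (g : (Fin n → ℝ) → (Fin n → ℝ)) (S : Set (Fin n → ℝ)) : Prop :=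
  ∀ x ∈ S, ∀ y ∈ S, (∀ i, x i ≤ y i) → ∀ i, g x i ≤ g y i

/-- `f` is sub-homogeneous of degree `α` on the cone `S`. -/
def SubHomogeneousOn {n : ℕ} (f : (Fin n → ℝ) → (Fin n → ℝ)) (α : ℝ)
    (S : Set (Fin n → ℝ)) : Prop :=
  ∀ x ∈ S, ∀ c : ℝ, 1 ≤ c → ∀ i, f (c • x) i ≤ c ^ α * f x i

/-- Heterogeneous time-varying delays, continuous on `[0, ∞)` with values in `[0, τmax]`.
`τ i j t` is the delay of the component `j` in the equation of the component `i`. -/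
structure IsDelay {n : ℕ} (τmax : ℝ) (τ : Fin n → Fin n → ℝ → ℝ) : Prop where
  bound_nonneg : 0 ≤ τmax
  continuousOn : ∀ i j, ContinuousOn (τ i j) (Ici 0)
  nonneg : ∀ i j, ∀ t, 0 ≤ t → 0 ≤ τ i j t
  le_bound : ∀ i j, ∀ t, 0 ≤ t → τ i j t ≤ τmax

/-- The delayed state `(x₁(t - τ i 1 t), …, xₙ(t - τ i n t))` seen by the equation of `xᵢ`. -/
def delayed {n : ℕ} (τ : Fin n → Fin n → ℝ → ℝ) (x : ℝ → (Fin n → ℝ)) (i : Fin n) (t : ℝ) :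
    Fin n → ℝ :=
  fun j => x (t - τ i j t) j

/-- `x` is a solution on `[-τmax, ∞)`, in the domain `W` of the vector fields, of
`xᵢ'(t) = fᵢ(x(t)) + gᵢ(x₁(t - τ i 1 t), …, xₙ(t - τ i n t))` for `t ≥ 0`,
with `x = φ` on `[-τmax, 0]`. The derivative is two-sided for `t > 0` and one-sided at `t = 0`. -/
structure IsSolution {n : ℕ} (W : Set (Fin n → ℝ)) (f g : (Fin n → ℝ) → (Fin n → ℝ))
    (τmax : ℝ) (τ : Fin n → Fin n → ℝ → ℝ) (φ x : ℝ → (Fin n → ℝ)) : Prop where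
  initial : ∀ t ∈ Icc (-τmax) 0, x t = φ t
  mem : ∀ t, -τmax ≤ t → x t ∈ W
  delayed_mem : ∀ t, 0 ≤ t → ∀ i, delayed τ x i t ∈ W
  hasDeriv : ∀ t, 0 ≤ t → ∀ i,
    HasDerivWithinAt (fun s => x s i) (f (x t) i + g (delayed τ x i t) i) (Ici 0) t

/-- Nonnegative initial conditions: continuous functions from `[-τmax, 0]` to `ℝⁿ₊`. -/
def IsInitial {n : ℕ} (τmax : ℝ) (φ : ℝ → (Fin n → ℝ)) : Prop :=
  ContinuousOn φ (Icc (-τmax) 0) ∧ ∀ t ∈ Icc (-τmax) 0, φ t ∈ orthant n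

/-- `xs` is an equilibrium in `ℝⁿ₊` that is globally asymptotically stable with respect to
nonnegative initial conditions: it is Lyapunov stable, every nonnegative initial condition has
a solution on all of `[0, ∞)`, and the solution converges to `xs`. -/
structure IsGAS {n : ℕ} (W : Set (Fin n → ℝ)) (f g : (Fin n → ℝ) → (Fin n → ℝ))
    (τmax : ℝ) (τ : Fin n → Fin n → ℝ → ℝ) (xs : Fin n → ℝ) : Prop where
  mem_orthant : xs ∈ orthant n
  equilibrium : f xs + g xs = 0
  stable : ∀ ε : ℝ, 0 < ε → ∃ δ : ℝ, 0 < δ ∧ ∀ φ x : ℝ → (Fin n → ℝ), IsInitial τmax φ →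
    (∀ t ∈ Icc (-τmax) 0, ‖φ t - xs‖ < δ) → IsSolution W f g τmax τ φ x →
    ∀ t, 0 ≤ t → ‖x t - xs‖ < ε
  exists_solution : ∀ φ : ℝ → (Fin n → ℝ), IsInitial τmax φ →
    ∃ x : ℝ → (Fin n → ℝ), IsSolution W f g τmax τ φ x
  attractive : ∀ φ x : ℝ → (Fin n → ℝ), IsInitial τmax φ → IsSolution W f g τmax τ φ x →
    Tendsto x atTop (𝓝 xs)

end DelaySystem

/-! For any given delay, the global asymptotic stability of `xs` is equivalent to a condition in
which no delay occurs: `xs` is the greatest point of the orthant at which `f + g ≥ 0` and the least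
one at which `f + g ≤ 0`.

A constant path at a point of either kind is a sub- or a supersolution of the delay equation, so the
solutions starting there stay on one side of it. If they converge to `xs`, then `xs` is on that side
as well. Conversely, a box between two points of opposite kinds is invariant, and sub-homogeneity,
by scaling, turns one such box around `xs` into arbitrarily large ones. This gives existence and
boundedness, and small boxes around `xs` give stability. Finally, by a fluctuation argument,
`f + g ≥ 0` at the componentwise upper limits of a bounded solution and `f + g ≤ 0` at its lower
limits, so that both are equal to `xs`. -/

namespace DelaySystem

section VectorFields

variable {ι : Type*}

/-- Quasimonotonicity (the Kamke condition): each component of `f` is nondecreasing in all the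
variables but its own. It is the derivative-free form of cooperativity. -/
def QuasimonotoneOn (f : (ι → ℝ) → (ι → ℝ)) (S : Set (ι → ℝ)) : Prop :=
  ∀ ⦃x⦄, x ∈ S → ∀ ⦃y⦄, y ∈ S → x ≤ y → ∀ ⦃i⦄, x i = y i → f x i ≤ f y i

theorem QuasimonotoneOn.mono {f : (ι → ℝ) → (ι → ℝ)} {S T : Set (ι → ℝ)}
    (hf : QuasimonotoneOn f T) (hST : S ⊆ T) : QuasimonotoneOn f S :=
  fun _ hx _ hy => hf (hST hx) (hST hy)

theorem QuasimonotoneOn.add {f g : (ι → ℝ) → (ι → ℝ)} {S : Set (ι → ℝ)}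
    (hf : QuasimonotoneOn f S) (hg : QuasimonotoneOn g S) : QuasimonotoneOn (f + g) S :=
  fun _ hx _ hy hxy _ hi => add_le_add (hf hx hy hxy hi) (hg hx hy hxy hi)

theorem quasimonotoneOn_of_monotoneOn {f : (ι → ℝ) → (ι → ℝ)} {S : Set (ι → ℝ)}
    (hf : MonotoneOn f S) : QuasimonotoneOn f S :=
  fun _ hx _ hy hxy i _ => hf hx hy hxy i

/-- The points of the nonnegative orthant at which all the components of `F` are nonnegative. -/
def subequilibria (F : (ι → ℝ) → (ι → ℝ)) : Set (ι → ℝ) := {w | 0 ≤ w ∧ 0 ≤ F w}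

/-- The points of the nonnegative orthant at which all the components of `F` are nonpositive. -/
def superequilibria (F : (ι → ℝ) → (ι → ℝ)) : Set (ι → ℝ) := {w | 0 ≤ w ∧ F w ≤ 0}

/-- A maximal point of the box at which `F ≥ c`: increasing a single component `i` preserves the
other inequalities, so maximality forces equality wherever there is room to increase. -/
theorem QuasimonotoneOn.exists_le_and_eq_of_lt [Finite ι] {F : (ι → ℝ) → (ι → ℝ)}
    {c p q : ι → ℝ} (hF : QuasimonotoneOn F (Icc q p)) (hFc : ContinuousOn F (Icc q p))
    (hqp : q ≤ p) (hq : c ≤ F q) :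
    ∃ w ∈ Icc q p, c ≤ F w ∧ ∀ i, w i < p i → F w i = c i := by
  classical
  have := Fintype.ofFinite ι
  have hS : IsCompact (Icc q p ∩ F ⁻¹' Ici c) :=
    isCompact_Icc.of_isClosed_subset
      (hFc.preimage_isClosed_of_isClosed isClosed_Icc isClosed_Ici) inter_subset_left
  obtain ⟨w, ⟨hw, hcw⟩, hmax⟩ := hS.exists_isMaxOn ⟨q, ⟨le_rfl, hqp⟩, hq⟩
    (f := fun z => ∑ i, z i) (by fun_prop)
  refine ⟨w, hw, hcw, fun i hi => ?_⟩
  have hwr : ∀ r ∈ Ioo (w i) (p i), w ≤ Function.update w i r ∧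
      Function.update w i r ∈ Icc q p := fun r hr =>
    have hle := le_update_self_iff.2 hr.1.le
    ⟨hle, hw.1.trans hle, update_le_iff.2 ⟨hr.2.le, fun j _ => hw.2 j⟩⟩
  have hlt : ∀ r ∈ Ioo (w i) (p i), F (Function.update w i r) i < c i := by
    intro r hr
    by_contra! hle
    refine (hmax (a := Function.update w i r) ⟨(hwr r hr).2, fun j => ?_⟩).not_gt
      (Finset.sum_lt_sum (fun j _ => (hwr r hr).1 j) ⟨i, Finset.mem_univ i, by simpa using hr.1⟩)
    rcases eq_or_ne j i with rfl | hj
    · exact hle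
    · exact (hcw j).trans (hF hw (hwr r hr).2 (hwr r hr).1 (by simp [hj]))
  have hlim : Tendsto (fun r => F (Function.update w i r) i) (𝓝[Ioo (w i) (p i)] w i)
      (𝓝 (F w i)) := by
    have hupd : Tendsto (Function.update w i) (𝓝[Ioo (w i) (p i)] w i) (𝓝[Icc q p] w) := by
      refine tendsto_nhdsWithin_iff.2 ⟨?_, ?_⟩
      · have hcont : Continuous (Function.update w i) := continuous_const.update i continuous_id
        exact (Function.update_eq_self i w ▸ hcont.tendsto (w i)).mono_left nhdsWithin_le_nhds
      · filter_upwards [self_mem_nhdsWithin] with r hr using (hwr r hr).2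
    exact ((continuous_apply i).tendsto _).comp ((hFc w hw).tendsto.comp hupd)
  have := left_nhdsWithin_Ioo_neBot hi
  refine le_antisymm (le_of_tendsto hlim ?_) (hcw i)
  filter_upwards [self_mem_nhdsWithin] with r hr using (hlt r hr).le

end VectorFields

section Hypotheses

variable {n : ℕ}

theorem IsMetzler.mulVec_nonneg {A : Matrix (Fin n) (Fin n) ℝ} (hA : IsMetzler A)
    {v : Fin n → ℝ} (hv : 0 ≤ v) {i : Fin n} (hi : v i = 0) : 0 ≤ A.mulVec v i := by
  rw [Matrix.mulVec, dotProduct]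
  refine Finset.sum_nonneg fun j _ => ?_
  rcases eq_or_ne i j with rfl | hij
  · rw [hi, mul_zero]
  · exact mul_nonneg (hA i j hij) (hv j)

theorem jacobian_mulVec (f : (Fin n → ℝ) → (Fin n → ℝ)) (a v : Fin n → ℝ) :
    (jacobian f a).mulVec v = fderiv ℝ f a v := by
  have : jacobian f a = LinearMap.toMatrix' (fderiv ℝ f a : (Fin n → ℝ) →ₗ[ℝ] (Fin n → ℝ)) := by
    ext i j
    simp [jacobian, LinearMap.toMatrix'_apply]
  rw [this, LinearMap.toMatrix'_mulVec]
  rfl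

theorem CooperativeOn.quasimonotoneOn {f : (Fin n → ℝ) → (Fin n → ℝ)} {S : Set (Fin n → ℝ)}
    (hf : CooperativeOn f S) (hS : Convex ℝ S) (hfd : ∀ a ∈ S, DifferentiableAt ℝ f a) :
    QuasimonotoneOn f S := by
  intro x hx y hy hxy i hi
  obtain ⟨z, hz, hmvt⟩ := domain_mvt (f := fun a => f a i)
    (fun a ha => (hasFDerivAt_pi'.1 (hfd a ha).hasFDerivAt i).hasFDerivWithinAt) hS hx hy
  have hnonneg := (hf z (hS.segment_subset hx hy hz)).mulVec_nonneg (sub_nonneg.2 hxy)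
    (i := i) (by simp [hi])
  rw [jacobian_mulVec] at hnonneg
  exact sub_nonneg.1 (hnonneg.trans_eq hmvt.symm)

theorem OrderPreservingOn.monotoneOn {g : (Fin n → ℝ) → (Fin n → ℝ)} {S : Set (Fin n → ℝ)}
    (hg : OrderPreservingOn g S) : MonotoneOn g S :=
  fun x hx y hy hxy => hg x hx y hy hxy

variable {f g : (Fin n → ℝ) → (Fin n → ℝ)} {α : ℝ}

theorem SubHomogeneousOn.add {S : Set (Fin n → ℝ)} (hf : SubHomogeneousOn f α S)
    (hg : SubHomogeneousOn g α S) : SubHomogeneousOn (f + g) α S :=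
  fun x hx c hc i => (add_le_add (hf x hx c hc i) (hg x hx c hc i)).trans_eq (mul_add _ _ _).symm

theorem SubHomogeneousOn.apply_zero_nonneg (hf : SubHomogeneousOn f α (orthant n))
    (hα : 0 < α) : 0 ≤ f 0 := by
  intro i
  have h := hf 0 (fun _ => le_rfl) 2 one_le_two i
  rw [smul_zero] at h
  have h2 : (1 : ℝ) < 2 ^ α := Real.one_lt_rpow one_lt_two hα
  exact nonneg_of_mul_nonneg_right (a := 2 ^ α - 1) (by linarith) (by linarith)

theorem SubHomogeneousOn.smul_mem_superequilibria (hf : SubHomogeneousOn f α (orthant n))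
    {w : Fin n → ℝ} (hw : w ∈ superequilibria f) {c : ℝ} (hc : 1 ≤ c) :
    c • w ∈ superequilibria f :=
  have hc0 : 0 ≤ c := zero_le_one.trans hc
  ⟨smul_nonneg hc0 hw.1, fun i => (hf w hw.1 c hc i).trans
    (mul_nonpos_of_nonneg_of_nonpos (Real.rpow_nonneg hc0 α) (hw.2 i))⟩

theorem SubHomogeneousOn.smul_mem_subequilibria (hf : SubHomogeneousOn f α (orthant n))
    {w : Fin n → ℝ} (hw : w ∈ subequilibria f) {c : ℝ} (hc : 0 < c) (hc1 : c ≤ 1) :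
    c • w ∈ subequilibria f := by
  refine ⟨smul_nonneg hc.le hw.1, fun i => ?_⟩
  have h := hf (c • w) (smul_nonneg hc.le hw.1) c⁻¹ ((one_le_inv₀ hc).2 hc1) i
  rw [inv_smul_smul₀ hc.ne'] at h
  exact nonneg_of_mul_nonneg_right ((hw.2 i).trans h) (Real.rpow_pos_of_pos (inv_pos.2 hc) α)

/-- The standing assumptions on the two vector fields of a delay system, in the form in which the
proof uses them. Quasimonotonicity of `f` and monotonicity of `g` make the semiflow of the delay
system order-preserving; local Lipschitz continuity makes it well-defined. -/
structure IsMonotoneSystem (W : Set (Fin n → ℝ)) (f g : (Fin n → ℝ) → (Fin n → ℝ)) : Prop where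
  Ici_subset : Ici 0 ⊆ W
  locallyLipschitzOn_left : LocallyLipschitzOn W f
  locallyLipschitzOn_right : LocallyLipschitzOn W g
  quasimonotoneOn : QuasimonotoneOn f (Ici 0)
  monotoneOn : MonotoneOn g (Ici 0)

theorem IsMonotoneSystem.of_contDiffOn {W : Set (Fin n → ℝ)} (hWo : IsOpen W)
    (hWc : Convex ℝ W) (hW : orthant n ⊆ W) (hf : ContDiffOn ℝ 1 f W) (hg : ContDiffOn ℝ 1 g W)
    (hfc : CooperativeOn f (orthant n)) (hgo : OrderPreservingOn g (orthant n)) :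
    IsMonotoneSystem W f g where
  Ici_subset := hW
  locallyLipschitzOn_left := hf.locallyLipschitzOn hWc
  locallyLipschitzOn_right := hg.locallyLipschitzOn hWc
  quasimonotoneOn := hfc.quasimonotoneOn (convex_Ici 0) fun _ ha =>
    (hf.differentiableOn one_ne_zero).differentiableAt (hWo.mem_nhds (hW ha))
  monotoneOn := hgo.monotoneOn

variable {W : Set (Fin n → ℝ)}

theorem IsMonotoneSystem.quasimonotoneOn_add (h : IsMonotoneSystem W f g) :
    QuasimonotoneOn (f + g) (Ici 0) :=
  h.quasimonotoneOn.add (quasimonotoneOn_of_monotoneOn h.monotoneOn)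

theorem IsMonotoneSystem.continuousOn_left (h : IsMonotoneSystem W f g) :
    ContinuousOn f (Ici 0) :=
  h.locallyLipschitzOn_left.continuousOn.mono h.Ici_subset

theorem IsMonotoneSystem.continuousOn_right (h : IsMonotoneSystem W f g) :
    ContinuousOn g (Ici 0) :=
  h.locallyLipschitzOn_right.continuousOn.mono h.Ici_subset

end Hypotheses

section FirstCrossing

theorem nonpos_of_hasDerivWithinAt_of_isMinOn {h : ℝ → ℝ} {h' a t : ℝ} (hat : a < t)
    (hd : HasDerivWithinAt h h' (Icc a t) t) (hmin : IsMinOn h (Icc a t) t) : h' ≤ 0 := by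
  have hseg : segment ℝ t a ⊆ Icc a t := by rw [segment_symm, segment_eq_Icc hat.le]
  have h := hmin.localize.hasFDerivWithinAt_nonneg hd.hasFDerivWithinAt
    (sub_mem_posTangentConeAt_of_segment_subset hseg)
  rw [ContinuousLinearMap.toSpanSingleton_apply, smul_eq_mul] at h
  exact nonpos_of_mul_nonneg_right h (sub_neg.2 hat)

variable {ι : Type*} [Finite ι] {T : ℝ}

theorem exists_isFirstZero {h : ℝ → ι → ℝ} (hc : ContinuousOn h (Icc 0 T)) (h0 : ∀ i, 0 < h 0 i)
    {t : ℝ} (ht : t ∈ Icc 0 T) {i : ι} (hti : h t i ≤ 0) :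
    ∃ t₀ ∈ Ioc 0 T, (∀ s ∈ Icc 0 t₀, 0 ≤ h s) ∧ ∃ j, h t₀ j = 0 := by
  have hA : IsCompact (⋃ j, {s ∈ Icc 0 T | h s j ≤ 0}) := isCompact_iUnion fun j =>
    isCompact_Icc.of_isClosed_subset ((continuousOn_pi.1 hc j).preimage_isClosed_of_isClosed
      isClosed_Icc isClosed_Iic) inter_subset_left
  obtain ⟨t₀, ht₀, hmin⟩ := hA.exists_isLeast ⟨t, mem_iUnion.2 ⟨i, ht, hti⟩⟩
  obtain ⟨j, htT, hj⟩ := mem_iUnion.1 ht₀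
  have hpos : t₀ ≠ 0 := fun h => (h0 j).not_ge (h ▸ hj)
  have hbefore : ∀ s ∈ Ico 0 t₀, 0 ≤ h s := by
    intro s hs k
    by_contra! hk
    exact hs.2.not_ge (hmin (mem_iUnion.2 ⟨k, ⟨hs.1, hs.2.le.trans htT.2⟩, hk.le⟩))
  have hupto : ∀ s ∈ Icc 0 t₀, 0 ≤ h s := by
    have hcl : closure (Ico 0 t₀) = Icc 0 t₀ := closure_Ico hpos.symm
    have hct : ContinuousOn h (closure (Ico 0 t₀)) :=
      hc.mono (hcl.trans_subset (Icc_subset_Icc_right htT.2))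
    exact fun s hs => le_on_closure hbefore continuousOn_const hct (hcl.symm ▸ hs)
  exact ⟨t₀, ⟨htT.1.lt_of_ne' hpos, htT.2⟩, hupto, j,
    hj.antisymm (hupto t₀ (right_mem_Icc.2 htT.1) j)⟩

theorem pos_of_barrier {h h' : ℝ → ι → ℝ} (h0 : ∀ i, 0 < h 0 i)
    (hd : ∀ t ∈ Icc 0 T, HasDerivWithinAt h (h' t) (Ici 0) t)
    (hb : ∀ t ∈ Icc 0 T, ∀ i, (∀ s ∈ Icc 0 t, 0 ≤ h s) → h t i = 0 → 0 < h' t i) :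
    ∀ t ∈ Icc 0 T, ∀ i, 0 < h t i := by
  have := Fintype.ofFinite ι
  intro t ht i
  by_contra! hti
  have hc : ContinuousOn h (Icc 0 T) :=
    fun s hs => (hd s hs).continuousWithinAt.mono Icc_subset_Ici_self
  obtain ⟨t₀, ht₀, hnonneg, j, hj⟩ := exists_isFirstZero hc h0 ht hti
  have ht₀' := Ioc_subset_Icc_self ht₀
  refine (hb t₀ ht₀' j hnonneg hj).not_ge (nonpos_of_hasDerivWithinAt_of_isMinOn ht₀.1
    ((hasDerivWithinAt_pi.1 (hd t₀ ht₀') j).mono Icc_subset_Ici_self) fun s hs => ?_)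
  exact hj.trans_le (hnonneg s hs j)

/-- The strict version is applied to `u + ε e^{Dt}` with `D` larger than all the `C i`. -/
theorem nonneg_of_barrier {a : ℝ} {C : ι → ℝ} {u u' : ℝ → ι → ℝ} (ha : a ≤ 0)
    (h0 : ∀ t ∈ Icc a 0, 0 ≤ u t)
    (hd : ∀ t ∈ Icc 0 T, HasDerivWithinAt u (u' t) (Ici 0) t)
    (hb : ∀ t ∈ Icc 0 T, ∀ i, ∀ η : ℝ, 0 < η → (∀ s ∈ Icc a t, ∀ j, -η ≤ u s j) →
      u t i = -η → -(C i * η) ≤ u' t i) :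
    ∀ t ∈ Icc 0 T, 0 ≤ u t := by
  obtain ⟨M, hM⟩ := Finite.exists_le C
  set D : ℝ := max M 0 + 1
  have hDpos : 0 < D := by positivity
  have hCD : ∀ i, C i < D := fun i => ((hM i).trans (le_max_left M 0)).trans_lt (lt_add_one _)
  have key : ∀ ε : ℝ, 0 < ε → ∀ t ∈ Icc 0 T, ∀ i, 0 < u t i + ε * Real.exp (D * t) := by
    intro ε hε
    refine pos_of_barrier (h := fun t i => u t i + ε * Real.exp (D * t))
      (h' := fun t i => u' t i + ε * (Real.exp (D * t) * D)) (fun i => ?_) (fun t ht => ?_) ?_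
    · have := h0 0 ⟨ha, le_rfl⟩ i
      exact add_pos_of_nonneg_of_pos this (by positivity)
    · refine hasDerivWithinAt_pi.2 fun i => (hasDerivWithinAt_pi.1 (hd t ht) i).add ?_
      have := ((hasDerivAt_id t).const_mul D).exp.const_mul ε
      simpa only [id, mul_one] using this.hasDerivWithinAt
    · intro t ht i hnonneg hzero
      have hη : 0 < ε * Real.exp (D * t) := by positivity
      have hlower : ∀ s ∈ Icc a t, ∀ j, -(ε * Real.exp (D * t)) ≤ u s j := by
        intro s hs j
        rcases le_or_gt s 0 with hs0 | hs0
        · exact (neg_nonpos.2 hη.le).trans (h0 s ⟨hs.1, hs0⟩ j)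
        · have hexp : ε * Real.exp (D * s) ≤ ε * Real.exp (D * t) :=
            mul_le_mul_of_nonneg_left (Real.exp_le_exp.2
              (mul_le_mul_of_nonneg_left hs.2 hDpos.le)) hε.le
          have : 0 ≤ u s j + ε * Real.exp (D * s) := hnonneg s ⟨hs0.le, hs.2⟩ j
          linarith
      have := hb t ht i _ hη hlower (eq_neg_of_add_eq_zero_left hzero)
      linarith [mul_lt_mul_of_pos_right (hCD i) hη]
  intro t ht i
  by_contra! hneg
  have hexp := Real.exp_pos (D * t)
  have := key (-u t i / Real.exp (D * t)) (div_pos (neg_pos.2 hneg) hexp) t ht i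
  rw [div_mul_cancel₀ _ hexp.ne', add_neg_cancel] at this
  exact this.false

end FirstCrossing

theorem exists_dist_comp_le {X Y Z : Type*} [TopologicalSpace X] [PseudoMetricSpace Y]
    [PseudoMetricSpace Z] {f : Y → Z} {W : Set Y} (hf : LocallyLipschitzOn W f) {I : Set X}
    (hI : IsCompact I) {a b : X → Y} (ha : ContinuousOn a I) (hb : ContinuousOn b I)
    (haW : MapsTo a I W) (hbW : MapsTo b I W) :
    ∃ L : NNReal, ∀ t ∈ I, dist (f (a t)) (f (b t)) ≤ L * dist (a t) (b t) := by
  have hK : IsCompact (a '' I ∪ b '' I) :=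
    (hI.image_of_continuousOn ha).union (hI.image_of_continuousOn hb)
  obtain ⟨L, hL⟩ := LocallyLipschitzOn.exists_lipschitzOnWith_of_compact hK
    (hf.mono (union_subset haW.image_subset hbW.image_subset))
  exact ⟨L, fun t ht => hL.dist_le_mul _ (.inl (mem_image_of_mem a ht)) _
    (.inr (mem_image_of_mem b ht))⟩

section DelayedState

variable {n : ℕ} {τmax : ℝ} {τ : Fin n → Fin n → ℝ → ℝ}

theorem isDelay_zero : IsDelay 0 (fun _ _ _ => 0 : Fin n → Fin n → ℝ → ℝ) where
  bound_nonneg := le_rfl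
  continuousOn _ _ := continuousOn_const
  nonneg _ _ _ _ := le_rfl
  le_bound _ _ _ _ := le_rfl

theorem IsDelay.sub_mem_Icc_sub (hτ : IsDelay τmax τ) (i j : Fin n) {t : ℝ} (ht : 0 ≤ t) :
    t - τ i j t ∈ Icc (t - τmax) t :=
  ⟨sub_le_sub_left (hτ.le_bound i j t ht) t, sub_le_self t (hτ.nonneg i j t ht)⟩

theorem IsDelay.sub_mem (hτ : IsDelay τmax τ) (i j : Fin n) {t : ℝ} (ht : 0 ≤ t) :
    t - τ i j t ∈ Icc (-τmax) t :=
  Icc_subset_Icc_left (by linarith) (hτ.sub_mem_Icc_sub i j ht)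

theorem IsDelay.continuousOn_delayed (hτ : IsDelay τmax τ) {x : ℝ → (Fin n → ℝ)}
    (hx : ContinuousOn x (Ici (-τmax))) (i : Fin n) : ContinuousOn (delayed τ x i) (Ici 0) :=
  continuousOn_pi.2 fun j => (continuousOn_pi.1 hx j).comp
    (continuousOn_id.sub (hτ.continuousOn i j)) fun _ ht => (hτ.sub_mem i j ht).1

theorem IsDelay.delayed_mem_Icc (hτ : IsDelay τmax τ) {x : ℝ → (Fin n → ℝ)} {a b : Fin n → ℝ}
    {t : ℝ} (ht : 0 ≤ t) (hx : ∀ s ∈ Icc (-τmax) t, x s ∈ Icc a b) (i : Fin n) :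
    delayed τ x i t ∈ Icc a b :=
  ⟨fun j => (hx _ (hτ.sub_mem i j ht)).1 j, fun j => (hx _ (hτ.sub_mem i j ht)).2 j⟩

theorem IsDelay.delayed_nonneg (hτ : IsDelay τmax τ) {x : ℝ → (Fin n → ℝ)}
    (hx : ∀ s, -τmax ≤ s → 0 ≤ x s) {t : ℝ} (ht : 0 ≤ t) (i : Fin n) : 0 ≤ delayed τ x i t :=
  fun j => hx _ (hτ.sub_mem i j ht).1 j

/-- The right-hand side of the delay equation along the path `x` at time `t`. -/
def delayField (f g : (Fin n → ℝ) → (Fin n → ℝ)) (τ : Fin n → Fin n → ℝ → ℝ)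
    (x : ℝ → (Fin n → ℝ)) (t : ℝ) : Fin n → ℝ :=
  fun i => f (x t) i + g (delayed τ x i t) i

variable {W : Set (Fin n → ℝ)} {f g : (Fin n → ℝ) → (Fin n → ℝ)} {φ x : ℝ → (Fin n → ℝ)}

theorem IsSolution.hasDerivWithinAt (hx : IsSolution W f g τmax τ φ x) {t : ℝ} (ht : 0 ≤ t) :
    HasDerivWithinAt x (delayField f g τ x t) (Ici 0) t :=
  hasDerivWithinAt_pi.2 (hx.hasDeriv t ht)

theorem IsSolution.continuousOn (hx : IsSolution W f g τmax τ φ x) (hφ : IsInitial τmax φ) :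
    ContinuousOn x (Ici (-τmax)) := by
  have hpast : ContinuousOn x (Icc (-τmax) 0) := hφ.1.congr hx.initial
  have hfuture : ContinuousOn x (Ici 0) := fun t ht => (hx.hasDerivWithinAt ht).continuousWithinAt
  refine (hpast.union_of_isClosed hfuture isClosed_Icc isClosed_Ici).mono fun t ht => ?_
  exact (le_total t 0).imp (fun h => ⟨ht, h⟩) id

end DelayedState

section Comparison

variable {n : ℕ} {τmax : ℝ} {τ : Fin n → Fin n → ℝ → ℝ} {W : Set (Fin n → ℝ)}
  {f g : (Fin n → ℝ) → (Fin n → ℝ)} {φ x : ℝ → (Fin n → ℝ)} {w : Fin n → ℝ}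

theorem continuousOn_pi_sup {X ι : Type*} [TopologicalSpace X] {a b : X → ι → ℝ} {I : Set X}
    (ha : ContinuousOn a I) (hb : ContinuousOn b I) : ContinuousOn (fun t => a t ⊔ b t) I :=
  continuousOn_pi.2 fun i => (continuousOn_pi.1 ha i).sup (continuousOn_pi.1 hb i)

theorem apply_le_add_mul_of_le_apply_sup {x y : Fin n → ℝ} {i : Fin n} {L : NNReal} {η : ℝ}
    (hmono : f x i ≤ f (x ⊔ y) i) (hlip : dist (f (x ⊔ y)) (f y) ≤ L * dist (x ⊔ y) y)
    (hη : 0 ≤ η) (hxy : ∀ j, x j ≤ y j + η) : f x i ≤ f y i + L * η := by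
  have hdist : dist (x ⊔ y) y ≤ η := (dist_pi_le_iff hη).2 fun j => by
    rw [Pi.sup_apply, Real.dist_eq, abs_of_nonneg (sub_nonneg.2 le_sup_right), sub_le_iff_le_add']
    exact sup_le (hxy j) (le_add_of_nonneg_right hη)
  have hle : f (x ⊔ y) i - f y i ≤ L * η :=
    ((le_abs_self _).trans (dist_le_pi_dist (f (x ⊔ y)) (f y) i)).trans
      (hlip.trans (mul_le_mul_of_nonneg_left hdist L.2))
  linarith

/-- A nonnegative path along which the delay differential inequality `x' ≤ f + g` holds. -/
structure IsSubsolution (f g : (Fin n → ℝ) → (Fin n → ℝ)) (τmax : ℝ)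
    (τ : Fin n → Fin n → ℝ → ℝ) (x : ℝ → (Fin n → ℝ)) : Prop where
  nonneg : ∀ t, -τmax ≤ t → 0 ≤ x t
  continuousOn : ContinuousOn x (Ici (-τmax))
  exists_hasDerivWithinAt : ∀ t, 0 ≤ t →
    ∃ v, HasDerivWithinAt x v (Ici 0) t ∧ v ≤ delayField f g τ x t

/-- A path along which the delay differential inequality `f + g ≤ x'` holds. It may leave the
orthant, but not the domain `W`, so that solutions are supersolutions before they are known to be
nonnegative. -/
structure IsSupersolution (W : Set (Fin n → ℝ)) (f g : (Fin n → ℝ) → (Fin n → ℝ)) (τmax : ℝ)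
    (τ : Fin n → Fin n → ℝ → ℝ) (x : ℝ → (Fin n → ℝ)) : Prop where
  mem : ∀ t, -τmax ≤ t → x t ∈ W
  delayed_mem : ∀ t, 0 ≤ t → ∀ i, delayed τ x i t ∈ W
  continuousOn : ContinuousOn x (Ici (-τmax))
  exists_hasDerivWithinAt : ∀ t, 0 ≤ t →
    ∃ v, HasDerivWithinAt x v (Ici 0) t ∧ delayField f g τ x t ≤ v

theorem IsSolution.isSupersolution (hx : IsSolution W f g τmax τ φ x) (hφ : IsInitial τmax φ) :
    IsSupersolution W f g τmax τ x :=
  ⟨hx.mem, hx.delayed_mem, hx.continuousOn hφ, fun _ ht => ⟨_, hx.hasDerivWithinAt ht, le_rfl⟩⟩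

theorem IsSolution.isSubsolution (hx : IsSolution W f g τmax τ φ x) (hφ : IsInitial τmax φ)
    (hx0 : ∀ t, -τmax ≤ t → 0 ≤ x t) : IsSubsolution f g τmax τ x :=
  ⟨hx0, hx.continuousOn hφ, fun _ ht => ⟨_, hx.hasDerivWithinAt ht, le_rfl⟩⟩

theorem isSubsolution_const (hw : w ∈ subequilibria (f + g)) :
    IsSubsolution f g τmax τ fun _ => w :=
  ⟨fun _ _ => hw.1, continuousOn_const, fun t _ => ⟨0, hasDerivWithinAt_const t _ w, hw.2⟩⟩

theorem isSupersolution_const (hW : Ici 0 ⊆ W) (hw : w ∈ superequilibria (f + g)) :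
    IsSupersolution W f g τmax τ fun _ => w :=
  ⟨fun _ _ => hW hw.1, fun _ _ _ => hW hw.1, continuousOn_const,
    fun t _ => ⟨0, hasDerivWithinAt_const t _ w, hw.2⟩⟩

/-- The barrier argument for `y - x`. Since `y` may leave the orthant, where nothing is known about
monotonicity, the fields at `x` are first compared with those at `x ⊔ y`. -/
theorem IsMonotoneSystem.le_of_le_initial (h : IsMonotoneSystem W f g) (hτ : IsDelay τmax τ)
    {y : ℝ → (Fin n → ℝ)} (hx : IsSubsolution f g τmax τ x) (hy : IsSupersolution W f g τmax τ y)
    (hxy : ∀ t ∈ Icc (-τmax) 0, x t ≤ y t) {t : ℝ} (ht : -τmax ≤ t) : x t ≤ y t := by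
  rcases le_total t 0 with ht0 | ht0
  · exact hxy t ⟨ht, ht0⟩
  choose! x' hxd hx' using hx.exists_hasDerivWithinAt
  choose! y' hyd hy' using hy.exists_hasDerivWithinAt
  have hpast : ∀ s ∈ Icc 0 t, -τmax ≤ s := fun s hs => (neg_nonpos.2 hτ.bound_nonneg).trans hs.1
  have hx0 : ∀ s ∈ Icc 0 t, 0 ≤ x s := fun s hs => hx.nonneg s (hpast s hs)
  have hxd0 : ∀ s ∈ Icc 0 t, ∀ i, 0 ≤ delayed τ x i s := fun s hs =>
    hτ.delayed_nonneg hx.nonneg hs.1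
  have hIcc : Icc 0 t ⊆ Ici 0 := Icc_subset_Ici_self
  have hyc := hy.continuousOn.mono hpast
  have hyc' := fun i => (hτ.continuousOn_delayed hy.continuousOn i).mono hIcc
  obtain ⟨L, hL⟩ := exists_dist_comp_le h.locallyLipschitzOn_left isCompact_Icc
    (continuousOn_pi_sup (hx.continuousOn.mono hpast) hyc) hyc
    (fun s hs => h.Ici_subset ((hx0 s hs).trans le_sup_left)) fun s hs => hy.mem s (hpast s hs)
  choose M hM using fun i => exists_dist_comp_le h.locallyLipschitzOn_right isCompact_Icc
    (continuousOn_pi_sup ((hτ.continuousOn_delayed hx.continuousOn i).mono hIcc) (hyc' i)) (hyc' i)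
    (fun s hs => h.Ici_subset ((hxd0 s hs i).trans le_sup_left))
    fun s hs => hy.delayed_mem s hs.1 i
  refine sub_nonneg.1 (nonneg_of_barrier (C := fun i => L + M i) (u := y - x) (u' := y' - x')
    (neg_nonpos.2 hτ.bound_nonneg) (fun s hs => sub_nonneg.2 (hxy s hs))
    (fun s hs => (hyd s hs.1).sub (hxd s hs.1)) ?_ t ⟨ht0, le_rfl⟩)
  intro s hs i η hη hlower (hcross : y s i - x s i = -η)
  have hle : ∀ r ∈ Icc (-τmax) s, ∀ j, x r j ≤ y r j + η := fun r hr j =>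
    neg_le_sub_iff_le_add.1 (hlower r hr j)
  have hxi : x s i = (x s ⊔ y s) i := (sup_eq_left.2 (by linarith)).symm
  have hfi := apply_le_add_mul_of_le_apply_sup
    (h.quasimonotoneOn (hx0 s hs) ((hx0 s hs).trans le_sup_left) le_sup_left hxi)
    (hL s hs) hη.le (hle s ⟨hpast s hs, le_rfl⟩)
  have hgi := apply_le_add_mul_of_le_apply_sup
    (h.monotoneOn (hxd0 s hs i) ((hxd0 s hs i).trans le_sup_left) le_sup_left i)
    (hM i s hs) hη.le fun j => hle _ (hτ.sub_mem i j hs.1) j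
  have hxi' : x' s i ≤ f (x s) i + g (delayed τ x i s) i := hx' s hs.1 i
  have hyi' : f (y s) i + g (delayed τ y i s) i ≤ y' s i := hy' s hs.1 i
  simp only [Pi.sub_apply]
  linarith

theorem IsMonotoneSystem.le_solution (h : IsMonotoneSystem W f g) (hτ : IsDelay τmax τ)
    (hφ : IsInitial τmax φ) (hx : IsSolution W f g τmax τ φ x)
    (hw : w ∈ subequilibria (f + g)) (hwφ : ∀ t ∈ Icc (-τmax) 0, w ≤ φ t) {t : ℝ}
    (ht : -τmax ≤ t) : w ≤ x t :=
  h.le_of_le_initial hτ (isSubsolution_const hw) (hx.isSupersolution hφ)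
    (fun s hs => (hwφ s hs).trans_eq (hx.initial s hs).symm) ht

theorem IsMonotoneSystem.solution_nonneg (h : IsMonotoneSystem W f g) (h0 : 0 ≤ (f + g) 0)
    (hτ : IsDelay τmax τ) (hφ : IsInitial τmax φ) (hx : IsSolution W f g τmax τ φ x) {t : ℝ}
    (ht : -τmax ≤ t) : 0 ≤ x t :=
  h.le_solution hτ hφ hx ⟨le_rfl, h0⟩ hφ.2 ht

theorem IsMonotoneSystem.solution_le (h : IsMonotoneSystem W f g) (h0 : 0 ≤ (f + g) 0)
    (hτ : IsDelay τmax τ) (hφ : IsInitial τmax φ) (hx : IsSolution W f g τmax τ φ x)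
    (hw : w ∈ superequilibria (f + g)) (hφw : ∀ t ∈ Icc (-τmax) 0, φ t ≤ w) {t : ℝ}
    (ht : -τmax ≤ t) : x t ≤ w :=
  h.le_of_le_initial hτ (hx.isSubsolution hφ fun _ => h.solution_nonneg h0 hτ hφ hx)
    (isSupersolution_const h.Ici_subset hw)
    (fun s hs => (hx.initial s hs).trans_le (hφw s hs)) ht

end Comparison

section GlobalExistence

open scoped BoundedContinuousFunction

variable {E : Type*} [NormedAddCommGroup E]

/-- The functional `H` of paths is causal, its value at time `t` depending on the path up to time
`t` only, and it is Lipschitz for the supremum distance of the paths up to time `t`. -/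
def CausalLipschitzWith (L : NNReal) (H : (ℝ → E) → ℝ → E) : Prop :=
  ∀ x y t η, 0 ≤ t → (∀ s ≤ t, dist (x s) (y s) ≤ η) → dist (H x t) (H y t) ≤ L * η

theorem CausalLipschitzWith.norm_le {L : NNReal} {H : (ℝ → E) → ℝ → E}
    (hH : CausalLipschitzWith L H) {M : ℝ} (hM : ∀ t, 0 ≤ t → ‖H 0 t‖ ≤ M) {x : ℝ → E} {t η : ℝ}
    (ht : 0 ≤ t) (hx : ∀ s ≤ t, ‖x s‖ ≤ η) : ‖H x t‖ ≤ M + L * η := by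
  have hdist := hH x 0 t η ht fun s hs => (dist_zero_right (x s)).trans_le (hx s hs)
  rw [dist_eq_norm] at hdist
  exact (norm_le_norm_add_norm_sub' _ _).trans (add_le_add (hM t ht) hdist)

variable [NormedSpace ℝ E]

theorem norm_exp_smul_integral_le {K A T : ℝ} (hK : 0 < K) (hA : 0 ≤ A) (hT : 0 ≤ T) {h : ℝ → E}
    (hh : ∀ s, 0 ≤ s → ‖h s‖ ≤ A * Real.exp (K * s)) :
    ‖Real.exp (-(K * T)) • ∫ s in (0 : ℝ)..T, h s‖ ≤ A / K := by
  have hint : ∫ s in (0 : ℝ)..T, A * Real.exp (K * s) = A / K * (Real.exp (K * T) - 1) := by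
    rw [intervalIntegral.integral_const_mul,
      intervalIntegral.integral_comp_mul_left (fun s => Real.exp s) hK.ne', integral_exp, mul_zero,
      Real.exp_zero, smul_eq_mul]
    ring
  have hle : ‖∫ s in (0 : ℝ)..T, h s‖ ≤ A / K * (Real.exp (K * T) - 1) :=
    (intervalIntegral.norm_integral_le_of_norm_le hT (.of_forall fun s hs => hh s hs.1.le)
      (Continuous.intervalIntegrable (by fun_prop) _ _)).trans_eq hint
  rw [norm_smul, Real.norm_of_nonneg (Real.exp_pos _).le]
  calc Real.exp (-(K * T)) * ‖∫ s in (0 : ℝ)..T, h s‖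
      ≤ Real.exp (-(K * T)) * (A / K * Real.exp (K * T)) := by
        gcongr
        exact hle.trans (by gcongr; exact sub_le_self _ zero_le_one)
    _ = A / K := by rw [mul_left_comm, ← Real.exp_add, neg_add_cancel, Real.exp_zero, mul_one]

/-- The path with past `ψ` whose increment on `[0, ∞)` is `exp (K t) z`. The weight turns the Picard
iteration on the whole half-line into a contraction in `z`. -/
noncomputable def weightedPath (K : ℝ) (ψ z : ℝ →ᵇ E) (t : ℝ) : E :=
  ψ (min t 0) + Real.exp (K * max t 0) • z t

/-- The Picard iteration for `x' = H x` in the variable `z` of `weightedPath`. -/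
noncomputable def picardMap (K : ℝ) (H : (ℝ → E) → ℝ → E) (ψ z : ℝ →ᵇ E) (t : ℝ) : E :=
  Real.exp (-(K * max t 0)) • ∫ s in (0 : ℝ)..max t 0, H (weightedPath K ψ z) (max s 0)

variable {K M : ℝ} {L : NNReal} {H : (ℝ → E) → ℝ → E} {ψ z z' : ℝ →ᵇ E}

theorem continuous_weightedPath : Continuous (weightedPath K ψ z) := by
  unfold weightedPath
  fun_prop

theorem dist_weightedPath_le (hK : 0 ≤ K) {s t : ℝ} (hst : s ≤ t) (ht : 0 ≤ t) :
    dist (weightedPath K ψ z s) (weightedPath K ψ z' s) ≤ dist z z' * Real.exp (K * t) := by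
  rw [weightedPath, weightedPath, dist_add_left, dist_smul₀, mul_comm,
    Real.norm_of_nonneg (Real.exp_pos _).le]
  gcongr
  · exact BoundedContinuousFunction.dist_coe_le_dist s
  · exact max_le hst ht

theorem norm_weightedPath_le (hK : 0 ≤ K) {s t : ℝ} (hst : s ≤ t) (ht : 0 ≤ t) :
    ‖weightedPath K ψ z s‖ ≤ (‖ψ‖ + ‖z‖) * Real.exp (K * t) := by
  have hψ : ‖weightedPath K ψ 0 s‖ ≤ ‖ψ‖ * Real.exp (K * t) := by
    rw [weightedPath, BoundedContinuousFunction.coe_zero, Pi.zero_apply, smul_zero, add_zero]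
    exact (ψ.norm_coe_le_norm _).trans
      (le_mul_of_one_le_right (norm_nonneg ψ) (Real.one_le_exp (by positivity)))
  have hz := dist_weightedPath_le (ψ := ψ) (z := z) (z' := 0) hK hst ht
  rw [dist_eq_norm, dist_zero_right] at hz
  rw [add_mul]
  exact (norm_le_norm_add_norm_sub' _ _).trans (add_le_add hψ hz)

theorem continuous_apply_weightedPath (hHc : ∀ x, Continuous x → ContinuousOn (H x) (Ici 0)) :
    Continuous fun s => H (weightedPath K ψ z) (max s 0) :=
  (hHc _ continuous_weightedPath).comp_continuous (by fun_prop) fun s => le_max_right s 0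

theorem continuous_picardMap (hHc : ∀ x, Continuous x → ContinuousOn (H x) (Ici 0)) :
    Continuous (picardMap K H ψ z) := by
  have hprim := intervalIntegral.continuous_primitive (μ := MeasureTheory.volume) (fun a b =>
    (continuous_apply_weightedPath (K := K) (ψ := ψ) (z := z) hHc).intervalIntegrable a b) 0
  exact Continuous.smul (by fun_prop) (hprim.comp (continuous_id.max continuous_const))

theorem CausalLipschitzWith.norm_picardMap_le (hH : CausalLipschitzWith L H) (hK : 0 < K)
    (hM : ∀ t, 0 ≤ t → ‖H 0 t‖ ≤ M) (t : ℝ) :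
    ‖picardMap K H ψ z t‖ ≤ (M + L * (‖ψ‖ + ‖z‖)) / K := by
  have hM0 : 0 ≤ M := (norm_nonneg _).trans (hM 0 le_rfl)
  refine norm_exp_smul_integral_le hK (by positivity) (le_max_right t 0) fun s hs => ?_
  rw [max_eq_left hs]
  have hexp : M ≤ M * Real.exp (K * s) :=
    le_mul_of_one_le_right hM0 (Real.one_le_exp (by positivity))
  linarith [hH.norm_le hM hs fun r hr => norm_weightedPath_le (ψ := ψ) (z := z) hK.le hr hs]

theorem CausalLipschitzWith.dist_picardMap_le (hH : CausalLipschitzWith L H) (hK : 0 < K)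
    (hHc : ∀ x, Continuous x → ContinuousOn (H x) (Ici 0)) (t : ℝ) :
    dist (picardMap K H ψ z t) (picardMap K H ψ z' t) ≤ L * dist z z' / K := by
  rw [dist_eq_norm, picardMap, picardMap, ← smul_sub, ← intervalIntegral.integral_sub
    ((continuous_apply_weightedPath hHc).intervalIntegrable _ _)
    ((continuous_apply_weightedPath hHc).intervalIntegrable _ _)]
  refine norm_exp_smul_integral_le hK (by positivity) (le_max_right t 0) fun s hs => ?_
  rw [max_eq_left hs, ← dist_eq_norm, mul_assoc]
  exact hH _ _ s _ hs fun r hr => dist_weightedPath_le hK.le hr hs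

variable [CompleteSpace E]

theorem CausalLipschitzWith.exists_picardMap_eq (hH : CausalLipschitzWith L H)
    (hHc : ∀ x, Continuous x → ContinuousOn (H x) (Ici 0)) (hM : ∀ t, 0 ≤ t → ‖H 0 t‖ ≤ M)
    (ψ : ℝ →ᵇ E) : ∃ z : ℝ →ᵇ E, ∀ t, picardMap (L + 1) H ψ z t = z t := by
  have hK : (0 : ℝ) < L + 1 := by positivity
  let P : (ℝ →ᵇ E) → (ℝ →ᵇ E) := fun z => .ofNormedAddCommGroup _ (continuous_picardMap hHc) _
    (hH.norm_picardMap_le (ψ := ψ) (z := z) hK hM)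
  have hP : ContractingWith (L / (L + 1)) P := by
    refine ⟨(div_lt_one (by positivity)).2 (lt_add_one L), .of_dist_le_mul fun z z' => ?_⟩
    refine (BoundedContinuousFunction.dist_le (by positivity)).2 fun t => ?_
    exact (hH.dist_picardMap_le hK hHc t).trans_eq (div_mul_eq_mul_div _ _ _).symm
  exact ⟨hP.fixedPoint P, fun t => DFunLike.congr_fun hP.fixedPoint_isFixedPt t⟩

theorem CausalLipschitzWith.exists_hasDerivWithinAt (hH : CausalLipschitzWith L H)
    (hHc : ∀ x, Continuous x → ContinuousOn (H x) (Ici 0)) (hM : ∀ t, 0 ≤ t → ‖H 0 t‖ ≤ M)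
    (ψ : ℝ →ᵇ E) :
    ∃ x : ℝ → E, (∀ t ≤ 0, x t = ψ t) ∧
      ∀ t, 0 ≤ t → HasDerivWithinAt x (H x t) (Ici 0) t := by
  obtain ⟨z, hz⟩ := hH.exists_picardMap_eq hHc hM ψ
  set x := weightedPath (L + 1) ψ z with hx
  have hxint : ∀ t, x t = ψ (min t 0) + ∫ s in (0 : ℝ)..max t 0, H x (max s 0) := by
    intro t
    rw [hx, weightedPath, ← hz, picardMap, smul_smul, ← Real.exp_add, add_neg_cancel,
      Real.exp_zero, one_smul]
  have hxpos : ∀ t, 0 ≤ t → x t = ψ 0 + ∫ s in (0 : ℝ)..t, H x (max s 0) := fun t ht => by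
    rw [hxint, min_eq_right ht, max_eq_left ht]
  refine ⟨x, fun t ht => ?_, fun t ht => ?_⟩
  · rw [hxint, min_eq_left ht, max_eq_right ht, intervalIntegral.integral_same, add_zero]
  · have hc : Continuous fun s => H x (max s 0) := continuous_apply_weightedPath hHc
    have hderiv := ((hc.integral_hasStrictDerivAt 0 t).hasDerivAt.const_add (ψ 0)).hasDerivWithinAt
      (s := Ici 0)
    rw [max_eq_left ht] at hderiv
    exact hderiv.congr (fun s hs => hxpos s hs) (hxpos t ht)

end GlobalExistence

section DelayExistence

open scoped BoundedContinuousFunction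

variable {n : ℕ} {τmax : ℝ} {τ : Fin n → Fin n → ℝ → ℝ} {f g : (Fin n → ℝ) → (Fin n → ℝ)}
  {φ : ℝ → (Fin n → ℝ)} {Lf Lg : NNReal}

theorem IsDelay.causalLipschitzWith_delayField (hτ : IsDelay τmax τ) (hf : LipschitzWith Lf f)
    (hg : LipschitzWith Lg g) : CausalLipschitzWith (Lf + Lg) (delayField f g τ) := by
  intro x y t η ht hxy
  have hη : 0 ≤ η := dist_nonneg.trans (hxy t le_rfl)
  have hdelayed : ∀ i, dist (delayed τ x i t) (delayed τ y i t) ≤ η := fun i =>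
    (dist_pi_le_iff hη).2 fun j =>
      (dist_le_pi_dist (x _) (y _) j).trans (hxy _ (hτ.sub_mem i j ht).2)
  refine (dist_pi_le_iff (by positivity)).2 fun i => ?_
  have hfi := (dist_le_pi_dist _ _ i).trans (hf.dist_le_mul_of_le (hxy t le_rfl))
  have hgi := (dist_le_pi_dist _ _ i).trans (hg.dist_le_mul_of_le (hdelayed i))
  rw [NNReal.coe_add, add_mul]
  exact (dist_add_add_le _ _ _ _).trans (add_le_add hfi hgi)

theorem IsDelay.continuousOn_delayField (hτ : IsDelay τmax τ) (hf : Continuous f)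
    (hg : Continuous g) {x : ℝ → (Fin n → ℝ)} (hx : ContinuousOn x (Ici (-τmax))) :
    ContinuousOn (delayField f g τ x) (Ici 0) :=
  continuousOn_pi.2 fun i =>
    ((continuous_apply i).comp_continuousOn (hf.comp_continuousOn
      (hx.mono (Ici_subset_Ici.2 (neg_nonpos.2 hτ.bound_nonneg))))).add
    ((continuous_apply i).comp_continuousOn (hg.comp_continuousOn (hτ.continuousOn_delayed hx i)))

theorem IsDelay.exists_isSolution (hτ : IsDelay τmax τ) (hf : LipschitzWith Lf f)
    (hg : LipschitzWith Lg g) (hφ : ContinuousOn φ (Icc (-τmax) 0)) :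
    ∃ x, IsSolution univ f g τmax τ φ x := by
  have hτ0 : -τmax ≤ 0 := neg_nonpos.2 hτ.bound_nonneg
  let ψ : ℝ →ᵇ (Fin n → ℝ) :=
    (BoundedContinuousFunction.mkOfCompact ⟨_, hφ.domRestrict⟩).compContinuous
      ⟨projIcc (-τmax) 0 hτ0, continuous_projIcc⟩
  obtain ⟨x, hpast, hderiv⟩ :=
    (hτ.causalLipschitzWith_delayField hf hg).exists_hasDerivWithinAt
      (fun x hx => hτ.continuousOn_delayField hf.continuous hg.continuous hx.continuousOn)
      (M := ‖(f + g) 0‖) (fun _ _ => le_rfl) ψ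
  refine ⟨x, fun t ht => ?_, fun _ _ => mem_univ _, fun _ _ _ => mem_univ _, fun t ht =>
    hasDerivWithinAt_pi.1 (hderiv t ht)⟩
  rw [hpast t ht.2]
  exact congrArg φ (congrArg Subtype.val (projIcc_of_mem hτ0 ht))

variable {W : Set (Fin n → ℝ)} {w : Fin n → ℝ}

/-- The componentwise projection onto the box `[0, w]`, used to truncate the vector fields. -/
def clamp (w x : Fin n → ℝ) : Fin n → ℝ := 0 ⊔ x ⊓ w

theorem clamp_mem_Icc (hw : 0 ≤ w) (x : Fin n → ℝ) : clamp w x ∈ Icc 0 w :=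
  ⟨le_sup_left, sup_le hw inf_le_right⟩

theorem clamp_of_mem_Icc {x : Fin n → ℝ} (hx : x ∈ Icc 0 w) : clamp w x = x := by
  rw [clamp, inf_eq_left.2 hx.2, sup_eq_right.2 hx.1]

theorem monotone_clamp : Monotone (clamp w) :=
  fun _ _ hxy => sup_le_sup_left (inf_le_inf_right w hxy) 0

theorem lipschitzWith_clamp : LipschitzWith 1 (clamp w) :=
  .of_dist_le_mul fun x y => (dist_pi_le_iff (by positivity)).2 fun i =>
    (((LipschitzWith.eval i).min_const (w i)).const_max 0).dist_le_mul x y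

theorem exists_lipschitzWith_comp_clamp (hf : LocallyLipschitzOn (Icc 0 w) f) (hw : 0 ≤ w) :
    ∃ L, LipschitzWith L (f ∘ clamp w) := by
  obtain ⟨L, hL⟩ := LocallyLipschitzOn.exists_lipschitzOnWith_of_compact isCompact_Icc hf
  exact ⟨L * 1, lipschitzOnWith_univ.1
    (hL.comp lipschitzWith_clamp.lipschitzOnWith fun x _ => clamp_mem_Icc hw x)⟩

theorem IsMonotoneSystem.comp_clamp (h : IsMonotoneSystem W f g) (hw : 0 ≤ w)
    (hf : LipschitzWith Lf (f ∘ clamp w)) (hg : LipschitzWith Lg (g ∘ clamp w)) :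
    IsMonotoneSystem univ (f ∘ clamp w) (g ∘ clamp w) where
  Ici_subset := subset_univ _
  locallyLipschitzOn_left := hf.locallyLipschitz.locallyLipschitzOn
  locallyLipschitzOn_right := hg.locallyLipschitz.locallyLipschitzOn
  quasimonotoneOn := fun x _ y _ hxy i hi => h.quasimonotoneOn (clamp_mem_Icc hw x).1
    (clamp_mem_Icc hw y).1 (monotone_clamp hxy) (congrArg (fun r => 0 ⊔ r ⊓ w i) hi)
  monotoneOn := fun x _ y _ hxy =>
    h.monotoneOn (clamp_mem_Icc hw x).1 (clamp_mem_Icc hw y).1 (monotone_clamp hxy)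

/-- Truncation outside the box `[0, w]` makes the fields globally Lipschitz and preserves their
monotonicity, so that by comparison the solution of the truncated system never leaves the box. -/
theorem IsMonotoneSystem.exists_isSolution (h : IsMonotoneSystem W f g) (h0 : 0 ≤ (f + g) 0)
    (hτ : IsDelay τmax τ) (hφ : IsInitial τmax φ) (hw : w ∈ superequilibria (f + g))
    (hφw : ∀ t ∈ Icc (-τmax) 0, φ t ≤ w) : ∃ x, IsSolution W f g τmax τ φ x := by
  have hIccW : Icc 0 w ⊆ W := fun _ hz => h.Ici_subset hz.1
  obtain ⟨Lf, hf⟩ := exists_lipschitzWith_comp_clamp (h.locallyLipschitzOn_left.mono hIccW) hw.1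
  obtain ⟨Lg, hg⟩ := exists_lipschitzWith_comp_clamp (h.locallyLipschitzOn_right.mono hIccW) hw.1
  obtain ⟨x, hx⟩ := hτ.exists_isSolution hf hg hφ.1
  have hclamp := h.comp_clamp hw.1 hf hg
  have hF : ∀ z ∈ Icc 0 w, (f ∘ clamp w + g ∘ clamp w) z = (f + g) z := fun z hz =>
    congrArg (f + g) (clamp_of_mem_Icc hz)
  have hF0 : 0 ≤ (f ∘ clamp w + g ∘ clamp w) 0 := h0.trans_eq (hF 0 ⟨le_rfl, hw.1⟩).symm
  have hFw : w ∈ superequilibria (f ∘ clamp w + g ∘ clamp w) :=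
    ⟨hw.1, (hF w ⟨hw.1, le_rfl⟩).trans_le hw.2⟩
  have hbox : ∀ t, -τmax ≤ t → x t ∈ Icc 0 w := fun t ht =>
    ⟨hclamp.solution_nonneg hF0 hτ hφ hx ht, hclamp.solution_le hF0 hτ hφ hx hFw hφw ht⟩
  have hdelayed : ∀ t, 0 ≤ t → ∀ i, delayed τ x i t ∈ Icc 0 w := fun t ht =>
    hτ.delayed_mem_Icc ht fun s hs => hbox s hs.1
  refine ⟨x, hx.initial, fun t ht => hIccW (hbox t ht), fun t ht i => hIccW (hdelayed t ht i),
    fun t ht i => ?_⟩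
  have hderiv := hx.hasDeriv t ht i
  rwa [Function.comp_apply, Function.comp_apply, clamp_of_mem_Icc (hdelayed t ht i),
    clamp_of_mem_Icc (hbox t ((neg_nonpos.2 hτ.bound_nonneg).trans ht))] at hderiv

end DelayExistence

section Fluctuation

variable {u u' : ℝ → ℝ} {c t₀ : ℝ}

theorem exists_le_of_deriv_le_neg {η : ℝ} (hη : 0 < η)
    (hd : ∀ t, t₀ ≤ t → HasDerivWithinAt u (u' t) (Ici t₀) t)
    (h : ∀ t, t₀ ≤ t → c ≤ u t → u' t ≤ -η) : ∃ t, t₀ ≤ t ∧ u t ≤ c := by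
  by_contra! hcon
  set T : ℝ := t₀ + (u t₀ - c) / η with hT
  have hTt : t₀ ≤ T :=
    le_add_of_nonneg_right (div_nonneg (sub_nonneg.2 (hcon t₀ le_rfl).le) hη.le)
  have hline : ∀ t, HasDerivAt (fun t => u t₀ - η * (t - t₀)) (-η) t := fun t => by
    simpa using (((hasDerivAt_id t).sub_const t₀).const_mul η).const_sub (u t₀)
  have hle : u T ≤ u t₀ - η * (T - t₀) :=
    image_le_of_deriv_right_le_deriv_boundary (f' := u')
      (fun t ht => (hd t ht.1).continuousWithinAt.mono Icc_subset_Ici_self)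
      (fun t ht => (hd t ht.1).mono (Ici_subset_Ici.2 ht.1)) (by simp) (by fun_prop)
      (fun t _ => (hline t).hasDerivWithinAt) (fun t ht => h t ht.1 (hcon t ht.1).le)
      ⟨hTt, le_rfl⟩
  rw [hT, add_sub_cancel_left, mul_div_cancel₀ _ hη.ne', sub_sub_cancel] at hle
  exact (hcon T hTt).not_ge hle

theorem eventually_le_of_deriv_le_neg {η : ℝ} (hη : 0 < η)
    (hd : ∀ t, t₀ ≤ t → HasDerivWithinAt u (u' t) (Ici t₀) t)
    (h : ∀ t, t₀ ≤ t → c ≤ u t → u' t ≤ -η) : ∀ᶠ t in atTop, u t ≤ c := by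
  obtain ⟨t₁, ht₁, hu₁⟩ := exists_le_of_deriv_le_neg hη hd h
  filter_upwards [eventually_ge_atTop t₁] with t ht
  exact image_le_of_deriv_right_lt_deriv_boundary (f' := u') (B := fun _ => c) (B' := fun _ => 0)
    (fun s hs => (hd s (ht₁.trans hs.1)).continuousWithinAt.mono fun r hr => ht₁.trans hr.1)
    (fun s hs => (hd s (ht₁.trans hs.1)).mono (Ici_subset_Ici.2 (ht₁.trans hs.1)))
    hu₁ (fun s => hasDerivAt_const s c)
    (fun s hs hs' => (h s (ht₁.trans hs.1) hs'.ge).trans_lt (neg_lt_zero.2 hη)) ⟨ht, le_rfl⟩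

theorem exists_forall_dist_le_add_le_neg {X : Type*} [PseudoMetricSpace X] {B : Set X}
    {p q : X → ℝ} {s : X} (hp : ContinuousWithinAt p B s) (hq : ContinuousWithinAt q B s)
    (hneg : p s + q s < 0) : ∃ κ > 0, ∃ ρ > 0, ∀ z ∈ B, ∀ z' ∈ B, dist z s ≤ ρ → dist z' s ≤ ρ →
      p z + q z' ≤ -κ := by
  set κ : ℝ := -(p s + q s) / 2 with hκ
  have hκpos : 0 < κ := half_pos (neg_pos.2 hneg)
  have hev : ∀ᶠ zz' in 𝓝[B] s ×ˢ 𝓝[B] s, p zz'.1 + q zz'.2 < -κ :=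
    ((hp.tendsto.comp tendsto_fst).add (hq.tendsto.comp tendsto_snd)).eventually_lt_const
      (by rw [hκ]; linarith)
  rw [← nhdsWithin_prod_eq] at hev
  obtain ⟨ε, hε, hball⟩ := Metric.mem_nhdsWithin_iff.1 hev
  refine ⟨κ, hκpos, ε / 2, half_pos hε, fun z hz z' hz' hzs hzs' => ?_⟩
  have hzz' : (z, z') ∈ Metric.ball (s, s) ε :=
    (max_le hzs hzs').trans_lt (half_lt_self hε)
  exact (hball ⟨hzz', hz, hz'⟩ : p z + q z' < -κ).le

theorem limsup_mem_Icc_of_eventually {X ι : Type*} {l : Filter X} [l.NeBot] {a b : ι → ℝ}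
    {x : X → ι → ℝ} (hx : ∀ᶠ t in l, x t ∈ Icc a b) :
    (fun i => limsup (fun t => x t i) l) ∈ Icc a b := by
  have hlow : ∀ i, ∀ᶠ t in l, a i ≤ x t i := fun i => hx.mono fun t ht => ht.1 i
  have hup : ∀ i, ∀ᶠ t in l, x t i ≤ b i := fun i => hx.mono fun t ht => ht.2 i
  exact ⟨fun i => le_limsup_of_frequently_le (hlow i).frequently
      (isBoundedUnder_of_eventually_le (hup i)),
    fun i => limsup_le_of_le (isBoundedUnder_of_eventually_ge (hlow i)).isCoboundedUnder_le
      (hup i)⟩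

theorem exists_eventually_le_of_limsup {X ι : Type*} {l : Filter X} [l.NeBot] [Fintype ι]
    {a b : ι → ℝ} {x : X → ι → ℝ} (hx : ∀ᶠ t in l, x t ∈ Icc a b) {ρ : ℝ} (hρ : 0 < ρ) :
    ∃ z ∈ Icc (fun i => limsup (fun t => x t i) l) b,
      dist z (fun i => limsup (fun t => x t i) l) ≤ ρ ∧ ∀ᶠ t in l, x t ≤ z := by
  have hs := limsup_mem_Icc_of_eventually hx
  set s : ι → ℝ := fun i => limsup (fun t => x t i) l
  have hsz : ∀ i, s i ≤ min (s i + ρ) (b i) := fun i =>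
    le_min (le_add_of_nonneg_right hρ.le) (hs.2 i)
  refine ⟨fun i => min (s i + ρ) (b i), ⟨hsz, fun i => min_le_right _ _⟩,
    (dist_pi_le_iff hρ.le).2 fun i => ?_, ?_⟩
  · rw [Real.dist_eq, abs_of_nonneg (sub_nonneg.2 (hsz i)), sub_le_iff_le_add']
    exact min_le_left _ _
  · have hlt : ∀ i, ∀ᶠ t in l, x t i < s i + ρ := fun i => eventually_lt_of_limsup_lt
      (lt_add_of_pos_right _ hρ) (isBoundedUnder_of_eventually_le (hx.mono fun t ht => ht.2 i))
    filter_upwards [hx, eventually_all.2 hlt] with t ht hlt i using le_min (hlt i).le (ht.2 i)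

variable {n : ℕ} {τmax : ℝ} {τ : Fin n → Fin n → ℝ → ℝ} {f g : (Fin n → ℝ) → (Fin n → ℝ)}
  {x : ℝ → (Fin n → ℝ)} {a b : Fin n → ℝ}

theorem IsDelay.delayField_apply_le (hτ : IsDelay τmax τ) (hf : QuasimonotoneOn f (Icc a b))
    (hg : MonotoneOn g (Icc a b)) {t : ℝ} (ht : 0 ≤ t) {z : Fin n → ℝ} (hzb : z ≤ b)
    (hx : ∀ s ∈ Icc (t - τmax) t, x s ∈ Icc a z) (i : Fin n) :
    Function.update z i (x t i) ∈ Icc a b ∧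
      delayField f g τ x t i ≤ f (Function.update z i (x t i)) i + g z i := by
  have hxt : x t ∈ Icc a z := hx t ⟨sub_le_self t hτ.bound_nonneg, le_rfl⟩
  have hxd : delayed τ x i t ∈ Icc a z :=
    ⟨fun j => (hx _ (hτ.sub_mem_Icc_sub i j ht)).1 j,
      fun j => (hx _ (hτ.sub_mem_Icc_sub i j ht)).2 j⟩
  have hle : x t ≤ Function.update z i (x t i) := le_update_iff.2 ⟨le_rfl, fun j _ => hxt.2 j⟩
  have hmem : Function.update z i (x t i) ∈ Icc a b :=
    ⟨hxt.1.trans hle, (update_le_self_iff.2 (hxt.2 i)).trans hzb⟩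
  exact ⟨hmem, add_le_add (hf ⟨hxt.1, hxt.2.trans hzb⟩ hmem hle (by simp))
    (hg ⟨hxd.1, hxd.2.trans hzb⟩ ⟨hxt.1.trans hxt.2, hzb⟩ hxd.2 i)⟩

/-- Otherwise the `i`-th component would decrease at a uniform rate whenever it is close to its
upper limit, because all the components are eventually below `z`, hence almost below their own
upper limits. -/
theorem IsDelay.nonneg_apply_limsup (hτ : IsDelay τmax τ) (hfc : ContinuousOn f (Icc a b))
    (hgc : ContinuousOn g (Icc a b)) (hf : QuasimonotoneOn f (Icc a b))
    (hg : MonotoneOn g (Icc a b)) (hx : ∀ t, -τmax ≤ t → x t ∈ Icc a b)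
    (hd : ∀ t, 0 ≤ t → HasDerivWithinAt x (delayField f g τ x t) (Ici 0) t) :
    0 ≤ (f + g) fun i => limsup (fun t => x t i) atTop := by
  have hxev : ∀ᶠ t in atTop, x t ∈ Icc a b := (eventually_ge_atTop (-τmax)).mono hx
  have hs := limsup_mem_Icc_of_eventually hxev
  have hex := fun ρ (hρ : 0 < ρ) => exists_eventually_le_of_limsup hxev hρ
  set s : Fin n → ℝ := fun i => limsup (fun t => x t i) atTop
  intro i
  by_contra! hneg
  obtain ⟨κ, hκ, ρ, hρ, hκρ⟩ := exists_forall_dist_le_add_le_neg (continuousOn_pi.1 hfc i s hs)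
    (continuousOn_pi.1 hgc i s hs) hneg
  obtain ⟨z, hz, hzs, hxz⟩ := hex ρ hρ
  obtain ⟨t₀, ht₀⟩ := eventually_atTop.1 (hxev.and hxz)
  have hT : 0 ≤ max t₀ 0 + τmax := add_nonneg (le_max_right _ _) hτ.bound_nonneg
  have hle : ∀ᶠ t in atTop, x t i ≤ s i - ρ := by
    refine eventually_le_of_deriv_le_neg (t₀ := max t₀ 0 + τmax) hκ
      (fun t ht => (hasDerivWithinAt_pi.1 (hd t (hT.trans ht)) i).mono (Ici_subset_Ici.2 hT)) ?_
    intro t ht hxt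
    have hwindow : ∀ r ∈ Icc (t - τmax) t, x r ∈ Icc a z := fun r hr =>
      have hr₀ := ht₀ r (by linarith [le_max_left t₀ 0, hr.1])
      ⟨hr₀.1.1, hr₀.2⟩
    obtain ⟨hmem, hfield⟩ := hτ.delayField_apply_le hf hg (hT.trans ht) hz.2 hwindow i
    have hxti : dist (x t i) (s i) ≤ ρ := by
      have hxzi := (hwindow t ⟨sub_le_self t hτ.bound_nonneg, le_rfl⟩).2 i
      have hzi := (abs_le.1 ((dist_pi_le_iff hρ.le).1 hzs i)).2
      exact abs_le.2 ⟨by linarith, by linarith⟩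
    refine hfield.trans (hκρ _ hmem z ⟨hs.1.trans hz.1, hz.2⟩
      ((dist_pi_le_iff hρ.le).2 fun j => ?_) hzs)
    rcases eq_or_ne j i with rfl | hj
    · simpa only [Function.update_self] using hxti
    · simpa only [Function.update_of_ne hj] using (dist_pi_le_iff hρ.le).1 hzs j
  have hcobdd := (isBoundedUnder_of_eventually_ge
    (hxev.mono fun t ht => ht.1 i)).isCoboundedUnder_le
  exact (sub_lt_self (s i) hρ).not_ge (limsup_le_of_le hcobdd hle)

/-- The vector field `x ↦ -f (-x)`, by which upper limits are exchanged with lower limits. -/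
def reflect (f : (Fin n → ℝ) → (Fin n → ℝ)) (x : Fin n → ℝ) : Fin n → ℝ := -f (-x)

theorem neg_mem_Icc_of_mem_Icc_neg {y : Fin n → ℝ} (hy : y ∈ Icc (-b) (-a)) : -y ∈ Icc a b :=
  ⟨le_neg_of_le_neg hy.2, neg_le_of_neg_le hy.1⟩

theorem continuousOn_reflect (hf : ContinuousOn f (Icc a b)) :
    ContinuousOn (reflect f) (Icc (-b) (-a)) :=
  (hf.comp continuousOn_neg fun _ => neg_mem_Icc_of_mem_Icc_neg).neg

theorem quasimonotoneOn_reflect (hf : QuasimonotoneOn f (Icc a b)) :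
    QuasimonotoneOn (reflect f) (Icc (-b) (-a)) :=
  fun _ hx _ hy hxy _ hi => neg_le_neg (hf (neg_mem_Icc_of_mem_Icc_neg hy)
    (neg_mem_Icc_of_mem_Icc_neg hx) (neg_le_neg hxy) (congrArg Neg.neg hi.symm))

theorem monotoneOn_reflect (hf : MonotoneOn f (Icc a b)) :
    MonotoneOn (reflect f) (Icc (-b) (-a)) :=
  fun _ hx _ hy hxy => neg_le_neg (hf (neg_mem_Icc_of_mem_Icc_neg hy)
    (neg_mem_Icc_of_mem_Icc_neg hx) (neg_le_neg hxy))

theorem delayField_reflect_neg (f g : (Fin n → ℝ) → (Fin n → ℝ)) (τ : Fin n → Fin n → ℝ → ℝ)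
    (x : ℝ → (Fin n → ℝ)) (t : ℝ) :
    delayField (reflect f) (reflect g) τ (-x) t = -delayField f g τ x t := by
  have hdelayed : ∀ i, -delayed τ (-x) i t = delayed τ x i t := fun i =>
    funext fun j => neg_neg _
  ext i
  simp only [delayField, reflect, Pi.neg_apply, neg_neg, hdelayed, neg_add]

theorem limsup_neg_of_eventually_mem_Icc {X : Type*} {l : Filter X} [l.NeBot] {v : X → ℝ}
    {c d : ℝ} (hv : ∀ᶠ t in l, v t ∈ Icc c d) : limsup (fun t => -v t) l = -liminf v l :=
  (Antitone.map_liminf_of_continuousAt (fun _ _ => neg_le_neg) v continuous_neg.continuousAt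
    (isBoundedUnder_of_eventually_le (hv.mono fun _ ht => ht.2)).isCoboundedUnder_ge
    (isBoundedUnder_of_eventually_ge (hv.mono fun _ ht => ht.1))).symm

theorem IsDelay.apply_liminf_nonpos (hτ : IsDelay τmax τ) (hfc : ContinuousOn f (Icc a b))
    (hgc : ContinuousOn g (Icc a b)) (hf : QuasimonotoneOn f (Icc a b))
    (hg : MonotoneOn g (Icc a b)) (hx : ∀ t, -τmax ≤ t → x t ∈ Icc a b)
    (hd : ∀ t, 0 ≤ t → HasDerivWithinAt x (delayField f g τ x t) (Ici 0) t) :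
    (f + g) (fun i => liminf (fun t => x t i) atTop) ≤ 0 := by
  have hlimsup : (fun i => limsup (fun t => (-x) t i) atTop) =
      -fun i => liminf (fun t => x t i) atTop := funext fun i =>
    limsup_neg_of_eventually_mem_Icc (c := a i) (d := b i)
      ((eventually_ge_atTop (-τmax)).mono fun t ht => ⟨(hx t ht).1 i, (hx t ht).2 i⟩)
  have h := hτ.nonneg_apply_limsup (continuousOn_reflect hfc) (continuousOn_reflect hgc)
    (quasimonotoneOn_reflect hf) (monotoneOn_reflect hg)
    (x := -x) (fun t ht => ⟨neg_le_neg (hx t ht).2, neg_le_neg (hx t ht).1⟩)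
    fun t ht => delayField_reflect_neg f g τ x t ▸ (hd t ht).neg
  rw [hlimsup] at h
  intro i
  have hi := h i
  simp only [Pi.add_apply, reflect, neg_neg, Pi.neg_apply, Pi.zero_apply] at hi ⊢
  linarith

end Fluctuation

section Equilibria

theorem exists_pos_forall_exists_apply_lt_neg {X ι : Type*} [TopologicalSpace X] [Finite ι]
    {K : Set X} {F : X → ι → ℝ} (hK : IsCompact K) (hF : ContinuousOn F K)
    (hneg : ∀ z ∈ K, ∃ i, F z i < 0) : ∃ ε > 0, ∀ z ∈ K, ∃ i, F z i < -ε := by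
  have := Fintype.ofFinite ι
  have hpart : ContinuousOn (fun z => ‖-F z ⊔ 0‖) K :=
    (continuousOn_pi_sup hF.neg continuousOn_const).norm
  obtain ⟨m, hm, hmK⟩ := hK.exists_forall_le' hpart (a := 0) fun z hz => by
    obtain ⟨i, hi⟩ := hneg z hz
    exact norm_pos_iff.2 fun h0 => (sup_eq_right.1 h0 i).not_gt (neg_pos.2 hi)
  refine ⟨m / 2, half_pos hm, fun z hz => ?_⟩
  by_contra! hge
  have hle : ‖-F z ⊔ 0‖ ≤ m / 2 := (pi_norm_le_iff_of_nonneg (half_pos hm).le).2 fun i => by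
    rw [Pi.sup_apply, Pi.neg_apply, Pi.zero_apply, Real.norm_of_nonneg le_sup_right]
    exact sup_le (neg_le.1 (hge i)) (half_pos hm).le
  exact ((hmK z hz).trans hle).not_gt (half_lt_self hm)

variable {n : ℕ} {F : (Fin n → ℝ) → (Fin n → ℝ)} {α : ℝ} {xs : Fin n → ℝ}

/-- Among the points of the box `[xs, xs + d]` where `F ≥ -ε`, take one that satisfies equality
wherever it has room to increase. For small `ε` this is everywhere, since by compactness the
point is close to a subequilibrium above `xs`, that is, to `xs`. -/
theorem QuasimonotoneOn.exists_superequilibrium_gt (hF : QuasimonotoneOn F (Ici 0))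
    (hFc : ContinuousOn F (Ici 0)) (hxs : IsGreatest (subequilibria F) xs) (hFxs : F xs = 0)
    {d : ℝ} (hd : 0 < d) : ∃ w ∈ superequilibria F, ∀ i, w i ∈ Ioo (xs i) (xs i + d) := by
  set p : Fin n → ℝ := fun i => xs i + d
  have hxp : xs ≤ p := fun i => le_add_of_nonneg_right hd.le
  have hIcc : Icc xs p ⊆ Ici 0 := fun z hz => hxs.1.1.trans hz.1
  have hK : IsCompact (Icc xs p ∩ ⋃ i, {z | p i ≤ z i}) := isCompact_Icc.inter_right
    (isClosed_iUnion_of_finite fun i => isClosed_le continuous_const (continuous_apply i))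
  obtain ⟨ε, hε, hεK⟩ := exists_pos_forall_exists_apply_lt_neg hK
    (hFc.mono (inter_subset_left.trans hIcc)) fun z ⟨hz, hzp⟩ => by
      obtain ⟨i, hi⟩ := mem_iUnion.1 hzp
      by_contra! hFz
      exact (hxs.2 ⟨hIcc hz, hFz⟩ i).not_gt ((lt_add_of_pos_right _ hd).trans_le hi)
  obtain ⟨w, hw, hFw, hroom⟩ := (hF.mono hIcc).exists_le_and_eq_of_lt (hFc.mono hIcc) hxp
    (c := fun _ => -ε) (hFxs ▸ fun _ => neg_nonpos.2 hε.le)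
  have hwp : ∀ i, w i < p i := fun i => by
    by_contra! hle
    obtain ⟨j, hj⟩ := hεK w ⟨hw, mem_iUnion.2 ⟨i, hle⟩⟩
    exact (hFw j).not_gt hj
  have hneg : ∀ i, F w i < 0 := fun i => (hroom i (hwp i)).trans_lt (neg_neg_of_pos hε)
  refine ⟨w, ⟨hIcc hw, fun i => (hneg i).le⟩, fun i => ⟨(hw.1 i).lt_of_ne fun heq => ?_, hwp i⟩⟩
  exact (hF hxs.1.1 (hIcc hw) hw.1 heq).not_gt (hFxs ▸ hneg i)

theorem SubHomogeneousOn.exists_superequilibrium_ge (hFs : SubHomogeneousOn F α (orthant n))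
    {w : Fin n → ℝ} (hw : w ∈ superequilibria F) (hpos : ∀ i, 0 < w i) (R : ℝ) :
    ∃ v ∈ superequilibria F, ∀ i, R ≤ v i := by
  have hlarge : ∀ᶠ c : ℝ in atTop, ∀ i, R ≤ c * w i := eventually_all.2 fun i =>
    (tendsto_id.atTop_mul_const (hpos i)).eventually_ge_atTop R
  obtain ⟨c, hc, hcR⟩ := ((eventually_ge_atTop 1).and hlarge).exists
  exact ⟨c • w, hFs.smul_mem_superequilibria hw hc, hcR⟩

theorem Ici_smul_mem_nhdsWithin {ι : Type*} [Finite ι] {x : ι → ℝ} (hx : 0 ≤ x) {c : ℝ}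
    (hc : c < 1) : Ici (c • x) ∈ 𝓝[Ici 0] x := by
  refine eventually_all.2 fun i => ?_
  rcases (hx i).eq_or_lt with h0 | hpos
  · filter_upwards [self_mem_nhdsWithin] with z (hz : 0 ≤ z)
    simpa [← h0] using hz i
  · exact nhdsWithin_le_nhds (((continuous_apply i).tendsto x).eventually_const_le
      (mul_lt_of_lt_one_left hpos hc))

theorem SubHomogeneousOn.exists_subequilibrium_gt (hFs : SubHomogeneousOn F α (orthant n))
    (hxs : xs ∈ subequilibria F) {ε : ℝ} (hε : 0 < ε) :
    ∃ q ∈ subequilibria F, Ici q ∈ 𝓝[Ici 0] xs ∧ ∀ i, xs i - ε < q i := by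
  have hnear : ∀ᶠ c : ℝ in 𝓝[<] 1, ∀ i, xs i - ε < c * xs i := by
    refine nhdsWithin_le_nhds (eventually_all.2 fun i => ?_)
    exact ((continuous_mul_const (xs i)).tendsto' 1 (xs i) (one_mul _)).eventually_const_lt
      (sub_lt_self _ hε)
  obtain ⟨c, hc, hc0, hc1⟩ := (hnear.and (Ioo_mem_nhdsLT one_pos)).exists
  exact ⟨c • xs, hFs.smul_mem_subequilibria hxs hc0 hc1.le, Ici_smul_mem_nhdsWithin hxs.1 hc1, hc⟩

theorem SubHomogeneousOn.exists_Icc_mem_nhdsWithin (hFs : SubHomogeneousOn F α (orthant n))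
    (hF : QuasimonotoneOn F (Ici 0)) (hFc : ContinuousOn F (Ici 0))
    (hxs : IsGreatest (subequilibria F) xs) (hFxs : F xs = 0) {ε : ℝ} (hε : 0 < ε) :
    ∃ q ∈ subequilibria F, ∃ w ∈ superequilibria F,
      Icc q w ∈ 𝓝[Ici 0] xs ∧ Icc q w ⊆ Metric.ball xs ε := by
  obtain ⟨q, hq, hqn, hqε⟩ := hFs.exists_subequilibrium_gt hxs.1 hε
  obtain ⟨w, hw, hwε⟩ := hF.exists_superequilibrium_gt hFc hxs hFxs hε
  refine ⟨q, hq, w, hw, inter_mem hqn (mem_nhdsWithin_of_mem_nhds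
    (pi_Iic_mem_nhds fun i => (hwε i).1)), fun z hz => (dist_pi_lt_iff hε).2 fun i => ?_⟩
  rw [Real.dist_eq, abs_sub_lt_iff]
  constructor <;> linarith [hz.1 i, hz.2 i, hqε i, (hwε i).2]

end Equilibria

section Stability

variable {n : ℕ} {τmax : ℝ} {τ : Fin n → Fin n → ℝ → ℝ} {W : Set (Fin n → ℝ)}
  {f g : (Fin n → ℝ) → (Fin n → ℝ)} {α : ℝ} {φ x : ℝ → (Fin n → ℝ)} {w xs : Fin n → ℝ}

theorem isInitial_const (hw : 0 ≤ w) : IsInitial τmax fun _ => w :=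
  ⟨continuousOn_const, fun _ _ => hw⟩

theorem IsGAS.isGreatest_subequilibria (hgas : IsGAS W f g τmax τ xs)
    (h : IsMonotoneSystem W f g) (hτ : IsDelay τmax τ) :
    IsGreatest (subequilibria (f + g)) xs := by
  refine ⟨⟨hgas.mem_orthant, hgas.equilibrium.ge⟩, fun w hw => ?_⟩
  have hφ : IsInitial τmax fun _ => w := isInitial_const hw.1
  obtain ⟨x, hx⟩ := hgas.exists_solution _ hφ
  refine ge_of_tendsto (hgas.attractive _ x hφ hx) ?_
  filter_upwards [eventually_ge_atTop (-τmax)] with t ht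
  exact h.le_solution hτ hφ hx hw (fun _ _ => le_rfl) ht

theorem IsGAS.isLeast_superequilibria (hgas : IsGAS W f g τmax τ xs)
    (h : IsMonotoneSystem W f g) (h0 : 0 ≤ (f + g) 0) (hτ : IsDelay τmax τ) :
    IsLeast (superequilibria (f + g)) xs := by
  refine ⟨⟨hgas.mem_orthant, hgas.equilibrium.le⟩, fun w hw => ?_⟩
  have hφ : IsInitial τmax fun _ => w := isInitial_const hw.1
  obtain ⟨x, hx⟩ := hgas.exists_solution _ hφ
  refine le_of_tendsto (hgas.attractive _ x hφ hx) ?_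
  filter_upwards [eventually_ge_atTop (-τmax)] with t ht
  exact h.solution_le h0 hτ hφ hx hw (fun _ _ => le_rfl) ht

theorem IsInitial.exists_le_superequilibrium (hφ : IsInitial τmax φ)
    {F : (Fin n → ℝ) → (Fin n → ℝ)} (hF : ∀ R, ∃ v ∈ superequilibria F, ∀ i, R ≤ v i) :
    ∃ v ∈ superequilibria F, ∀ t ∈ Icc (-τmax) 0, φ t ≤ v := by
  obtain ⟨R, hR⟩ := isCompact_Icc.exists_bound_of_continuousOn hφ.1
  obtain ⟨v, hv, hRv⟩ := hF R
  exact ⟨v, hv, fun t ht i =>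
    ((le_abs_self _).trans ((norm_le_pi_norm (φ t) i).trans (hR t ht))).trans (hRv i)⟩

theorem IsMonotoneSystem.tendsto_solution (h : IsMonotoneSystem W f g) (h0 : 0 ≤ (f + g) 0)
    (hτ : IsDelay τmax τ) (hsub : IsGreatest (subequilibria (f + g)) xs)
    (hsuper : IsLeast (superequilibria (f + g)) xs) (hφ : IsInitial τmax φ)
    (hx : IsSolution W f g τmax τ φ x) (hw : w ∈ superequilibria (f + g))
    (hφw : ∀ t ∈ Icc (-τmax) 0, φ t ≤ w) : Tendsto x atTop (𝓝 xs) := by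
  have hIcc : Icc 0 w ⊆ Ici 0 := Icc_subset_Ici_self
  have hbox : ∀ t, -τmax ≤ t → x t ∈ Icc 0 w := fun t ht =>
    ⟨h.solution_nonneg h0 hτ hφ hx ht, h.solution_le h0 hτ hφ hx hw hφw ht⟩
  have hev : ∀ᶠ t in atTop, x t ∈ Icc 0 w := (eventually_ge_atTop (-τmax)).mono hbox
  have hlow : ∀ i, IsBoundedUnder (· ≥ ·) atTop fun t => x t i := fun i =>
    isBoundedUnder_of_eventually_ge (hev.mono fun t ht => ht.1 i)
  have hup : ∀ i, IsBoundedUnder (· ≤ ·) atTop fun t => x t i := fun i =>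
    isBoundedUnder_of_eventually_le (hev.mono fun t ht => ht.2 i)
  have hlimsup := hsub.2 ⟨(limsup_mem_Icc_of_eventually hev).1,
    hτ.nonneg_apply_limsup (h.continuousOn_left.mono hIcc) (h.continuousOn_right.mono hIcc)
      (h.quasimonotoneOn.mono hIcc) (h.monotoneOn.mono hIcc) hbox fun t => hx.hasDerivWithinAt⟩
  have hliminf := hsuper.2 ⟨fun i => le_liminf_of_le (hup i).isCoboundedUnder_ge
      (hev.mono fun t ht => ht.1 i),
    hτ.apply_liminf_nonpos (h.continuousOn_left.mono hIcc) (h.continuousOn_right.mono hIcc)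
      (h.quasimonotoneOn.mono hIcc) (h.monotoneOn.mono hIcc) hbox fun t => hx.hasDerivWithinAt⟩
  exact tendsto_pi_nhds.2 fun i =>
    tendsto_of_le_liminf_of_limsup_le (hliminf i) (hlimsup i) (hup i) (hlow i)

theorem IsMonotoneSystem.isGAS (h : IsMonotoneSystem W f g) (hα : 0 < α)
    (hs : SubHomogeneousOn (f + g) α (orthant n)) (hτ : IsDelay τmax τ)
    (hsub : IsGreatest (subequilibria (f + g)) xs)
    (hsuper : IsLeast (superequilibria (f + g)) xs) : IsGAS W f g τmax τ xs := by
  have h0 : 0 ≤ (f + g) 0 := hs.apply_zero_nonneg hα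
  have hF := h.quasimonotoneOn_add
  have hFc := h.continuousOn_left.add h.continuousOn_right
  have hFxs : (f + g) xs = 0 := le_antisymm hsuper.1.2 hsub.1.2
  obtain ⟨u, hu, hxu⟩ := hF.exists_superequilibrium_gt hFc hsub hFxs one_pos
  have hlarge : ∀ φ, IsInitial τmax φ →
      ∃ w ∈ superequilibria (f + g), ∀ t ∈ Icc (-τmax) 0, φ t ≤ w := fun φ hφ =>
    hφ.exists_le_superequilibrium (hs.exists_superequilibrium_ge hu fun i =>
      (hsub.1.1 i).trans_lt (hxu i).1)
  refine ⟨hsub.1.1, hFxs, fun ε hε => ?_, fun φ hφ => ?_, fun φ x hφ hx => ?_⟩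
  · obtain ⟨q, hq, w, hw, hnhds, hball⟩ := hs.exists_Icc_mem_nhdsWithin hF hFc hsub hFxs hε
    obtain ⟨δ, hδ, hδbox⟩ := Metric.mem_nhdsWithin_iff.1 hnhds
    refine ⟨δ, hδ, fun φ x hφ hφδ hx t ht => ?_⟩
    have hφbox : ∀ s ∈ Icc (-τmax) 0, φ s ∈ Icc q w := fun s hs =>
      hδbox ⟨mem_ball_iff_norm.2 (hφδ s hs), hφ.2 s hs⟩
    have ht' : -τmax ≤ t := (neg_nonpos.2 hτ.bound_nonneg).trans ht
    exact mem_ball_iff_norm.1 (hball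
      ⟨h.le_solution hτ hφ hx hq (fun s hs => (hφbox s hs).1) ht',
        h.solution_le h0 hτ hφ hx hw (fun s hs => (hφbox s hs).2) ht'⟩)
  · obtain ⟨w, hw, hφw⟩ := hlarge φ hφ
    exact h.exists_isSolution h0 hτ hφ hw hφw
  · obtain ⟨w, hw, hφw⟩ := hlarge φ hφ
    exact h.tendsto_solution h0 hτ hsub hsuper hφ hx hw hφw

theorem IsMonotoneSystem.isGAS_iff (h : IsMonotoneSystem W f g) (hα : 0 < α)
    (hs : SubHomogeneousOn (f + g) α (orthant n)) (hτ : IsDelay τmax τ) :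
    IsGAS W f g τmax τ xs ↔
      IsGreatest (subequilibria (f + g)) xs ∧ IsLeast (superequilibria (f + g)) xs :=
  ⟨fun hgas => ⟨hgas.isGreatest_subequilibria h hτ,
    hgas.isLeast_superequilibria h (hs.apply_zero_nonneg hα) hτ⟩,
    fun ⟨hsub, hsuper⟩ => h.isGAS hα hs hτ hsub hsuper⟩

end Stability

end DelaySystem

theorem theorem2_general {n : ℕ} {W : Set (Fin n → ℝ)} {f g : (Fin n → ℝ) → (Fin n → ℝ)}
    (h : DelaySystem.IsMonotoneSystem W f g) {α : ℝ} (hα : 0 < α)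
    (hs : DelaySystem.SubHomogeneousOn (f + g) α (DelaySystem.orthant n)) (xs : Fin n → ℝ) :
    [ DelaySystem.IsGAS W f g 0 (fun _ _ _ => 0) xs,
      ∀ (τmax : ℝ) (τ : Fin n → Fin n → ℝ → ℝ), DelaySystem.IsDelay τmax τ →
        DelaySystem.IsGAS W f g τmax τ xs,
      ∃ (τmax : ℝ) (τ : Fin n → Fin n → ℝ → ℝ), DelaySystem.IsDelay τmax τ ∧
        DelaySystem.IsGAS W f g τmax τ xs ].TFAE := by
  tfae_have 2 → 1 := fun hall => hall 0 _ DelaySystem.isDelay_zero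
  tfae_have 1 → 3 := fun hzero => ⟨0, _, DelaySystem.isDelay_zero, hzero⟩
  tfae_have 3 → 2 := fun ⟨_, _, hτ, hgas⟩ _ _ hσ =>
    (h.isGAS_iff hα hs hσ).2 ((h.isGAS_iff hα hs hτ).1 hgas)
  tfae_finish

theorem theorem2 {n : ℕ} (W : Set (Fin n → ℝ)) (hWo : IsOpen W) (hWc : Convex ℝ W)
    (hW : DelaySystem.orthant n ⊆ W) (f g : (Fin n → ℝ) → (Fin n → ℝ))
    (hf : ContDiffOn ℝ 1 f W) (hg : ContDiffOn ℝ 1 g W)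
    (hfc : DelaySystem.CooperativeOn f (DelaySystem.orthant n))
    (hgo : DelaySystem.OrderPreservingOn g (DelaySystem.orthant n))
    (α : ℝ) (hα : 0 < α)
    (hfs : DelaySystem.SubHomogeneousOn f α (DelaySystem.orthant n))
    (hgs : DelaySystem.SubHomogeneousOn g α (DelaySystem.orthant n))
    (xs : Fin n → ℝ) :
    [ -- the system without delay
      DelaySystem.IsGAS W f g 0 (fun _ _ _ => 0) xs,
      -- the system with every choice of bounded delays
      ∀ (τmax : ℝ) (τ : Fin n → Fin n → ℝ → ℝ), DelaySystem.IsDelay τmax τ →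
        DelaySystem.IsGAS W f g τmax τ xs,
      -- the system with some choice of bounded delays
      ∃ (τmax : ℝ) (τ : Fin n → Fin n → ℝ → ℝ), DelaySystem.IsDelay τmax τ ∧
        DelaySystem.IsGAS W f g τmax τ xs ].TFAE :=
  theorem2_general (.of_contDiffOn hWo hWc hW hf hg hfc hgo) hα (hfs.add hgs) xs
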